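/- Let $G=(V,E)$ be a finite simple graph. A set $S\subseteq V$ is a general position set of $G$ if no three distinct vertices of $S$ lie on a common shortest path of $G$. The general position polynomial of $G$ is $\psi(G)=\sum_{i\ge 0}a_i x^i$, where $a_i$ is the number of general position sets of $G$ of cardinality $i$. The Kneser graph $K(n,2)$ has as its vertices the $2$-element subsets of an $n$-element set, two vertices being adjacent if and only if they are disjoint. A polynomial $\sum_{i\ge 0} a_i x^i$ with nonnegative integer coefficients is unimodal if there is an index $m$ with $a_0\le a_1\le\cdots\le a_m$ and $a_m\ge a_{m+1}\ge a_{m+2}\ge\cdots$. **Theorem.** For every integer $n\ge 2$, the general position polynomial $\psi(K(n,2))$ is unimodal. -/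

import Mathlib

/-- The Kneser graph `K(n,k)`: its vertices are the `k`-element subsets of an `n`-element set, and
two distinct vertices are adjacent if and only if they are disjoint. (For `k ≥ 1` disjoint
`k`-subsets are automatically distinct.) -/
def kneserGraph (n k : ℕ) : SimpleGraph {s : Finset (Fin n) // s.card = k} where
  Adj s t := s ≠ t ∧ Disjoint s.1 t.1
  symm := ⟨fun _ _ h => ⟨h.1.symm, h.2.symm⟩⟩
  loopless := ⟨fun _ h => h.1 rfl⟩

/-- A shortest path: a path whose length is the distance between its endpoints. -/
def IsShortestPath {V : Type*} (G : SimpleGraph V) {u v : V} (p : G.Walk u v) : Prop :=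
  p.IsPath ∧ p.length = G.dist u v

/-- A set `S` of vertices is a general position set if no three distinct vertices of `S` lie on a
common shortest path of `G`. -/
def IsGeneralPositionSet {V : Type*} (G : SimpleGraph V) (S : Finset V) : Prop :=
  ∀ x ∈ S, ∀ y ∈ S, ∀ z ∈ S, x ≠ y → x ≠ z → y ≠ z →
    ¬ ∃ (u v : V) (p : G.Walk u v), IsShortestPath G p ∧
      x ∈ p.support ∧ y ∈ p.support ∧ z ∈ p.support

/-- The number of general position sets of `G` of cardinality `i`. -/
noncomputable def numGeneralPositionSets {V : Type*} (G : SimpleGraph V) (i : ℕ) : ℕ :=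
  {S : Finset V | S.card = i ∧ IsGeneralPositionSet G S}.ncard

/-- The general position polynomial `∑ a_i x ^ i` of a finite graph `G`, where `a_i` is the number
of general position sets of cardinality `i`; these numbers vanish for `i > |V|`. -/
noncomputable def generalPositionPolynomial {V : Type*} [Fintype V] (G : SimpleGraph V) :
    Polynomial ℕ :=
  ∑ i ∈ Finset.range (Fintype.card V + 1),
    Polynomial.C (numGeneralPositionSets G i) * Polynomial.X ^ i

/-- A polynomial (with coefficients in `ℕ`) is unimodal if its coefficients are non-decreasing up
to some index `m` and non-increasing from `m` on. -/
def IsUnimodalPolynomial (p : Polynomial ℕ) : Prop :=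
  ∃ m : ℕ, (∀ i j : ℕ, i ≤ j → j ≤ m → p.coeff i ≤ p.coeff j) ∧
    (∀ i j : ℕ, m ≤ i → i ≤ j → p.coeff j ≤ p.coeff i)

open Finset

/-! ### Structure of families of pairs in which disjointness is transitive -/

section EdgeSets

variable {α : Type*}

/-! For `n ≥ 5` the graph `K(n,2)` has diameter at most two, so three vertices share a shortest path
exactly when they induce a path on three vertices. General position sets are thus the families of
pairs on which "disjoint or equal" is transitive. Such a family is a matching, a star, or lives on
four points (`IsCluster.matching_or_star_or_small`). For `k ≥ 4` these types exclude each other,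
which gives the coefficient `m k + n * (n-1).choose k + n.choose 4 * Nat.choose 6 k`, where `m k`
counts the `k`-matchings of the complete graph; sizes at most 3 are corrected by hand. For `n ≤ 4`
every set is in general position and the coefficients are binomial.

Unimodality is governed by the matchings, since `(k+1) * m (k+1) = (n-2k).choose 2 * m k`. For `n ≥
17` the mode is the first `k` with `(n-2k).choose 2 ≤ k`, and it is at least 7, where the four-point
term is already zero. Before it, matchings and stars both increase (from `k = 7` on; smaller `k` are
compared directly). After it, stars may still increase, but `star_mul_le_matchingNumber` bounds
their growth by the loss of matchings. The cases `5 ≤ n < 17` are a finite computation. -/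

/-- A family of sets in which being disjoint or equal is transitive. -/
def IsCluster (S : Finset (Finset α)) : Prop :=
  ∀ x ∈ S, ∀ y ∈ S, ∀ z ∈ S, Disjoint x y → Disjoint y z → x ≠ z → Disjoint x z

theorem isCluster_of_pairwiseDisjoint {S : Finset (Finset α)}
    (h : (S : Set (Finset α)).PairwiseDisjoint id) : IsCluster S :=
  fun _ hx _ _ _ hz _ _ hne => h hx hz hne

theorem isCluster_of_star {S : Finset (Finset α)} {v : α} (h : ∀ e ∈ S, v ∈ e) : IsCluster S :=
  fun x hx y hy _ _ hxy _ _ => (Finset.disjoint_left.1 hxy (h x hx) (h y hy)).elim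

section Fintype

variable [Fintype α]

variable (α) in
/-- The matchings with `k` edges of the complete graph on `α`. -/
noncomputable def matchings (k : ℕ) : Finset (Finset (Finset α)) :=
  open Classical in
  (powersetCard k (powersetCard 2 univ)).filter
    fun S => (S : Set (Finset α)).PairwiseDisjoint id

variable (α) in
/-- The cluster sets of `k` pairs. -/
noncomputable def clusters (k : ℕ) : Finset (Finset (Finset α)) :=
  open Classical in
  (powersetCard k (powersetCard 2 univ)).filter IsCluster

theorem mem_matchings {k : ℕ} {S : Finset (Finset α)} :
    S ∈ matchings α k ↔ (∀ e ∈ S, e.card = 2) ∧ S.card = k ∧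
      (S : Set (Finset α)).PairwiseDisjoint id := by
  simp [matchings, mem_powersetCard, subset_iff, and_assoc]

theorem mem_clusters {k : ℕ} {S : Finset (Finset α)} :
    S ∈ clusters α k ↔ (∀ e ∈ S, e.card = 2) ∧ S.card = k ∧ IsCluster S := by
  simp [clusters, mem_powersetCard, subset_iff, and_assoc]

theorem card_matchings_zero : (matchings α 0).card = 1 := by
  rw [Finset.card_eq_one]
  refine ⟨∅, ?_⟩
  ext S
  simp only [mem_matchings, mem_singleton, card_eq_zero]
  constructor
  · exact fun h => h.2.1
  · rintro rfl; simp

end Fintype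

variable [DecidableEq α]

theorem subset_pair_union_of_not_disjoint {x y h : Finset α} (hxy : Disjoint x y)
    (hh : h.card = 2) (hx : ¬ Disjoint h x) (hy : ¬ Disjoint h y) : h ⊆ x ∪ y := by
  rw [Finset.not_disjoint_iff_nonempty_inter, ← Finset.card_pos] at hx hy
  have h1 : (h ∩ x ∪ h ∩ y).card = (h ∩ x).card + (h ∩ y).card :=
    Finset.card_union_of_disjoint
      (Finset.disjoint_of_subset_left inter_subset_right
        (Finset.disjoint_of_subset_right inter_subset_right hxy))
  have h2 : h ∩ x ∪ h ∩ y = h :=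
    Finset.eq_of_subset_of_card_le (union_subset inter_subset_left inter_subset_left) (by omega)
  rw [← h2]
  exact union_subset_union inter_subset_right inter_subset_right

theorem card_le_of_three_meets {x y z g : Finset α} (hxy : Disjoint x y) (hyz : Disjoint y z)
    (hxz : Disjoint x z) (hx : ¬ Disjoint g x) (hy : ¬ Disjoint g y) (hz : ¬ Disjoint g z) :
    3 ≤ g.card := by
  rw [Finset.not_disjoint_iff] at hx hy hz
  obtain ⟨a, ha, hax⟩ := hx
  obtain ⟨b, hb, hby⟩ := hy
  obtain ⟨c, hc, hcz⟩ := hz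
  have hab : a ≠ b := fun h => Finset.disjoint_left.1 hxy hax (h ▸ hby)
  have hbc : b ≠ c := fun h => Finset.disjoint_left.1 hyz hby (h ▸ hcz)
  have hac : a ≠ c := fun h => Finset.disjoint_left.1 hxz hax (h ▸ hcz)
  rw [← Finset.card_eq_three.2 ⟨a, b, c, hab, hac, hbc, rfl⟩]
  exact Finset.card_le_card (by intro t; simp only [mem_insert, mem_singleton]; aesop)

/-- Pairwise intersecting pairs form a star or lie in a triangle. -/
theorem star_or_triangle {S : Finset (Finset α)} (hS : ∀ e ∈ S, e.card = 2) (hne : S.Nonempty)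
    (hint : ∀ x ∈ S, ∀ y ∈ S, ¬ Disjoint x y) :
    (∃ v, ∀ e ∈ S, v ∈ e) ∨ ∃ T : Finset α, T.card = 3 ∧ ∀ e ∈ S, e ⊆ T := by
  obtain ⟨e, he⟩ := hne
  obtain ⟨a, b, hab, rfl⟩ := Finset.card_eq_two.1 (hS e he)
  by_contra! hcon
  obtain ⟨hstar, htri⟩ := hcon
  obtain ⟨f, hf, haf⟩ := hstar a
  obtain ⟨g, hg, hbg⟩ := hstar b
  have hbf : b ∈ f := by
    have := hint _ he f hf
    simp_all [Finset.disjoint_left]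
  have hag : a ∈ g := by
    have := hint _ he g hg
    simp_all [Finset.disjoint_left]
  -- The set `f` avoids `a` and `g` avoids `b`, so with a common point `c` they are the other two
  -- sides of the triangle on `a`, `b`, `c`; a pair meeting all three sides lies inside it.
  obtain ⟨c, hcf, hcg⟩ := Finset.not_disjoint_iff.1 (hint f hf g hg)
  have hac : a ≠ c := fun h => haf (h ▸ hcf)
  have hbc : b ≠ c := fun h => hbg (h ▸ hcg)
  have hfe : {b, c} = f := Finset.eq_of_subset_of_card_le
    (by simp [Finset.insert_subset_iff, hbf, hcf]) (by rw [hS f hf, Finset.card_pair hbc])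
  have hge : {a, c} = g := Finset.eq_of_subset_of_card_le
    (by simp [Finset.insert_subset_iff, hag, hcg]) (by rw [hS g hg, Finset.card_pair hac])
  obtain ⟨h, hh, hnot⟩ := htri {a, b, c} (Finset.card_eq_three.2 ⟨a, b, c, hab, hac, hbc, rfl⟩)
  apply hnot
  have h1 := hint _ hh _ he
  have h2 := hint _ hh _ hf
  have h3 := hint _ hh _ hg
  rw [← hfe] at h2
  rw [← hge] at h3
  obtain ⟨p, q, hpq, rfl⟩ := Finset.card_eq_two.1 (hS h hh)
  simp only [Finset.disjoint_insert_left, Finset.disjoint_singleton_left, mem_insert,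
    mem_singleton] at h1 h2 h3
  simp only [Finset.insert_subset_iff, Finset.singleton_subset_iff, mem_insert, mem_singleton]
  clear * - h1 h2 h3 hpq hab hac hbc
  grind

/-- The edge sets without an induced path on three vertices in the Kneser graph of pairs. -/
theorem IsCluster.matching_or_star_or_small [Fintype α] (h4 : 4 ≤ Fintype.card α)
    {S : Finset (Finset α)} (hS : ∀ e ∈ S, e.card = 2) (hc : IsCluster S) :
    (S : Set (Finset α)).PairwiseDisjoint id ∨ (∃ v, ∀ e ∈ S, v ∈ e) ∨
      ∃ U : Finset α, U.card = 4 ∧ ∀ e ∈ S, e ⊆ U := by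
  by_cases hdis : ∃ x ∈ S, ∃ y ∈ S, Disjoint x y
  · obtain ⟨x, hx, y, hy, hxy⟩ := hdis
    have key : ∀ h ∈ S, h ≠ y → Disjoint h x → Disjoint h y := fun h hh hne hd =>
      hc h hh x hx y hy hd hxy hne
    have key' : ∀ h ∈ S, h ≠ x → Disjoint h y → Disjoint h x := fun h hh hne hd =>
      hc h hh y hy x hx hd hxy.symm hne
    by_cases hz : ∃ z ∈ S, Disjoint z x ∧ Disjoint z y
    · left
      obtain ⟨z, hz, hzx, hzy⟩ := hz
      -- A pair that meets `x` must, by transitivity, also meet `y` and `z`; three pairwise disjoint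
      -- sets are too many for two elements.
      have all : ∀ g ∈ S, g ≠ x → Disjoint g x := by
        intro g hg hgx
        by_contra hd
        have h1 : ¬ Disjoint g y := fun h => hd (key' g hg hgx h)
        have h2 : ¬ Disjoint g z := fun h => hd (hc g hg z hz x hx h hzx hgx)
        have := card_le_of_three_meets hxy hzy.symm hzx.symm hd h1 h2
        rw [hS g hg] at this
        omega
      intro g hg g' hg' hne
      by_cases h1 : g = x
      · subst h1
        exact (all g' hg' hne.symm).symm
      · by_cases h2 : g' = x
        · subst h2
          exact all g hg hne
        · exact hc g hg x hx g' hg' (all g hg h1) (all g' hg' h2).symm hne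
    -- With no third pair disjoint from both, transitivity forces every other pair to meet both `x`
    -- and `y`, hence to lie in their union.
    · right; right
      push Not at hz
      refine ⟨x ∪ y, by rw [Finset.card_union_of_disjoint hxy, hS x hx, hS y hy], fun h hh => ?_⟩
      by_cases h1 : h = x
      · subst h1; exact subset_union_left
      by_cases h2 : h = y
      · subst h2; exact subset_union_right
      refine subset_pair_union_of_not_disjoint hxy (hS h hh) (fun hd => ?_) (fun hd => ?_)
      · exact hz h hh hd (key h hh h2 hd)
      · exact hz h hh (key' h hh h1 hd) hd
  · push Not at hdis
    rcases S.eq_empty_or_nonempty with rfl | hne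
    · left; simp
    rcases star_or_triangle hS hne hdis with h | ⟨T, hT, hsub⟩
    · exact Or.inr (Or.inl h)
    · obtain ⟨U, hTU, hU⟩ := Finset.exists_superset_card_eq (s := T) (n := 4) (by omega) h4
      exact Or.inr (Or.inr ⟨U, hU, fun e he => (hsub e he).trans hTU⟩)

/-- Inside a four-element set a pair is disjoint from its complement only, so the hypotheses of
transitivity never hold for `x ≠ z`. -/
theorem isCluster_of_subset_four {S : Finset (Finset α)} {U : Finset α} (hU : U.card = 4)
    (hS : S ⊆ U.powersetCard 2) : IsCluster S := by
  have compl : ∀ x ∈ S, ∀ y ∈ S, Disjoint x y → x = U \ y := by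
    intro x hx y hy hd
    have hx' := Finset.mem_powersetCard.1 (hS hx)
    have hy' := Finset.mem_powersetCard.1 (hS hy)
    apply Finset.eq_of_subset_of_card_le
    · exact Finset.subset_sdiff.2 ⟨hx'.1, hd⟩
    · rw [Finset.card_sdiff_of_subset hy'.1]; omega
  intro x hx y hy z hz hxy hyz hne
  exact (hne ((compl x hx y hy hxy).trans (compl z hz y hy hyz.symm).symm)).elim

/-- The pairs in `U` containing `v`. -/
theorem filter_mem_powersetCard_two {U : Finset α} {v : α} (hv : v ∈ U) :
    (powersetCard 2 U).filter (v ∈ ·) = (U.erase v).image fun w => {v, w} := by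
  ext e
  simp only [mem_filter, mem_powersetCard, mem_image, mem_erase]
  constructor
  · rintro ⟨⟨hU, hc⟩, hve⟩
    obtain ⟨a, b, hab, rfl⟩ := Finset.card_eq_two.1 hc
    rcases mem_insert.1 hve with rfl | h
    · exact ⟨b, ⟨hab.symm, hU (by simp)⟩, rfl⟩
    · rw [mem_singleton] at h
      subst h
      exact ⟨a, ⟨hab, hU (by simp)⟩, Finset.pair_comm _ _⟩
  · rintro ⟨w, ⟨hwv, hw⟩, rfl⟩
    exact ⟨⟨by simp [insert_subset_iff, hv, hw], Finset.card_pair hwv.symm⟩, by simp⟩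

theorem card_filter_mem_powersetCard_two {U : Finset α} {v : α} (hv : v ∈ U) :
    ((powersetCard 2 U).filter (v ∈ ·)).card = U.card - 1 := by
  rw [filter_mem_powersetCard_two hv, Finset.card_image_of_injOn, card_erase_of_mem hv]
  intro a ha b hb hab
  have ha' : a ≠ v := (mem_erase.1 ha).1
  have : a ∈ ({v, b} : Finset α) := by
    have : ({v, a} : Finset α) = {v, b} := hab
    rw [← this]; simp
  simpa [ha'] using this

theorem subset_powersetCard_inter {S : Finset (Finset α)} {U V : Finset α} {k : ℕ}
    (hU : S ⊆ powersetCard k U) (hV : S ⊆ powersetCard k V) : S ⊆ powersetCard k (U ∩ V) :=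
  fun _ he => mem_powersetCard.2 ⟨subset_inter (mem_powersetCard.1 (hU he)).1
    (mem_powersetCard.1 (hV he)).1, (mem_powersetCard.1 (hU he)).2⟩

theorem card_inter_lt_of_ne {U V : Finset α} (hUV : U ≠ V) (h : U.card = V.card) :
    (U ∩ V).card < U.card := by
  refine Finset.card_lt_card (inter_subset_left.ssubset_of_ne fun hE => hUV ?_)
  exact Finset.eq_of_subset_of_card_le (inter_eq_left.1 hE) h.ge

theorem subset_of_powersetCard_two_subset {T U : Finset α} (hT : 2 ≤ T.card)
    (h : powersetCard 2 T ⊆ powersetCard 2 U) : T ⊆ U := by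
  intro t ht
  obtain ⟨s, hs, hst⟩ := Finset.exists_mem_ne (by omega : 1 < T.card) t
  have : ({t, s} : Finset α) ∈ powersetCard 2 U :=
    h (mem_powersetCard.2 ⟨by simp [insert_subset_iff, ht, hs], Finset.card_pair hst.symm⟩)
  exact (mem_powersetCard.1 this).1 (by simp)

variable (α) in
/-- The triangles, as sets of pairs, on the vertex set `U`. -/
def triangles (U : Finset α) : Finset (Finset (Finset α)) :=
  (powersetCard 3 U).image (powersetCard 2)

theorem card_triangles (U : Finset α) : (triangles α U).card = U.card.choose 3 := by
  rw [triangles, Finset.card_image_of_injOn, card_powersetCard]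
  intro T hT T' hT' h
  have hT := (mem_powersetCard.1 hT).2
  have hT' := (mem_powersetCard.1 hT').2
  exact (subset_of_powersetCard_two_subset (by omega) h.le).antisymm
    (subset_of_powersetCard_two_subset (by omega) h.ge)

theorem triangles_subset (U : Finset α) : triangles α U ⊆ powersetCard 3 (powersetCard 2 U) := by
  intro S hS
  obtain ⟨T, hT, rfl⟩ := mem_image.1 hS
  rw [mem_powersetCard] at hT ⊢
  exact ⟨powersetCard_mono hT.1, by rw [card_powersetCard, hT.2]; rfl⟩

/-! ### Counting the families of each type by size -/

variable [Fintype α]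

variable (α) in
/-- The sets of `k` pairs with a common element. -/
noncomputable def stars (k : ℕ) : Finset (Finset (Finset α)) :=
  open Classical in
  (powersetCard k (powersetCard 2 univ)).filter fun S => ∃ v, ∀ e ∈ S, v ∈ e

variable (α) in
/-- The sets of `k` pairs inside some four-element set. -/
def quads (k : ℕ) : Finset (Finset (Finset α)) :=
  (powersetCard 4 univ).biUnion fun U => powersetCard k (powersetCard 2 U)

theorem mem_stars {k : ℕ} {S : Finset (Finset α)} :
    S ∈ stars α k ↔ (∀ e ∈ S, e.card = 2) ∧ S.card = k ∧ ∃ v, ∀ e ∈ S, v ∈ e := by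
  simp [stars, mem_powersetCard, subset_iff, and_assoc]

theorem mem_quads {k : ℕ} {S : Finset (Finset α)} :
    S ∈ quads α k ↔ ∃ U : Finset α, U.card = 4 ∧ S ⊆ powersetCard 2 U ∧ S.card = k := by
  simp [quads, mem_powersetCard]

theorem clusters_eq (h4 : 4 ≤ Fintype.card α) (k : ℕ) :
    clusters α k = matchings α k ∪ stars α k ∪ quads α k := by
  ext S
  simp only [mem_union, mem_clusters, mem_matchings, mem_stars, mem_quads]
  constructor
  · rintro ⟨h2, hk, hc⟩
    rcases hc.matching_or_star_or_small h4 h2 with h | h | ⟨U, hU, h⟩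
    · exact Or.inl (Or.inl ⟨h2, hk, h⟩)
    · exact Or.inl (Or.inr ⟨h2, hk, h⟩)
    · exact Or.inr ⟨U, hU, fun e he => mem_powersetCard.2 ⟨h e he, h2 e he⟩, hk⟩
  · rintro ((⟨h2, hk, h⟩ | ⟨h2, hk, v, h⟩) | ⟨U, hU, h, hk⟩)
    · exact ⟨h2, hk, isCluster_of_pairwiseDisjoint h⟩
    · exact ⟨h2, hk, isCluster_of_star h⟩
    · exact ⟨fun e he => (mem_powersetCard.1 (h he)).2, hk, isCluster_of_subset_four hU h⟩

theorem card_biUnion_of_mem_matchings {k : ℕ} {S : Finset (Finset α)} (h : S ∈ matchings α k) :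
    (S.biUnion id).card = 2 * k := by
  obtain ⟨h2, hk, hd⟩ := mem_matchings.1 h
  rw [Finset.card_biUnion (fun x hx y hy hne => hd hx hy hne)]
  simp only [id_eq]
  rw [Finset.sum_congr rfl h2]
  simp [hk, mul_comm]

theorem disjoint_matchings_stars {k : ℕ} (hk : 2 ≤ k) : Disjoint (matchings α k) (stars α k) := by
  rw [Finset.disjoint_left]
  intro S hm hs
  obtain ⟨-, hc, hd⟩ := mem_matchings.1 hm
  obtain ⟨-, -, v, hv⟩ := mem_stars.1 hs
  obtain ⟨x, hx, y, hy, hne⟩ := Finset.one_lt_card.1 (by omega : 1 < S.card)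
  exact Finset.disjoint_left.1 (hd hx hy hne) (hv x hx) (hv y hy)

theorem disjoint_matchings_quads {k : ℕ} (hk : 3 ≤ k) : Disjoint (matchings α k) (quads α k) := by
  rw [Finset.disjoint_left]
  intro S hm hs
  obtain ⟨U, hU, hS, -⟩ := mem_quads.1 hs
  have h1 := card_biUnion_of_mem_matchings hm
  have h2 : S.biUnion id ⊆ U :=
    Finset.biUnion_subset.2 fun e he => (mem_powersetCard.1 (hS he)).1
  have := Finset.card_le_card h2
  omega

/-- Only three pairs of a four-element set contain a given point, which is why size 3 needs separate
treatment. -/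
theorem disjoint_stars_quads {k : ℕ} (hk : 4 ≤ k) : Disjoint (stars α k) (quads α k) := by
  rw [Finset.disjoint_left]
  intro S hs hq
  obtain ⟨U, hU, hS, hc⟩ := mem_quads.1 hq
  obtain ⟨-, -, v, hv⟩ := mem_stars.1 hs
  obtain ⟨e, he⟩ := Finset.card_pos.1 (by omega : 0 < S.card)
  have hvU : v ∈ U := (mem_powersetCard.1 (hS he)).1 (hv e he)
  have h1 : S ⊆ (powersetCard 2 U).filter (v ∈ ·) := fun x hx => mem_filter.2 ⟨hS hx, hv x hx⟩
  have := Finset.card_le_card h1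
  rw [card_filter_mem_powersetCard_two hvU] at this
  omega

theorem card_stars {k : ℕ} (hk : 2 ≤ k) :
    (stars α k).card = Fintype.card α * (Fintype.card α - 1).choose k := by
  have heq : stars α k =
      univ.biUnion fun v => powersetCard k ((powersetCard 2 (univ : Finset α)).filter (v ∈ ·)) := by
    ext S
    simp only [mem_stars, mem_biUnion, mem_univ, true_and, mem_powersetCard, subset_iff,
      mem_filter]
    constructor
    · rintro ⟨h2, hc, v, hv⟩
      exact ⟨v, fun e he => ⟨⟨by simp, h2 e he⟩, hv e he⟩, hc⟩
    · rintro ⟨v, h, hc⟩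
      exact ⟨fun e he => (h he).1.2, hc, v, fun e he => (h he).2⟩
  rw [heq, Finset.card_biUnion]
  · simp [card_powersetCard, card_filter_mem_powersetCard_two]
  · intro v _ w _ hvw
    rw [Function.onFun, Finset.disjoint_left]
    intro S h1 h2
    rw [mem_powersetCard] at h1 h2
    obtain ⟨x, hx, y, hy, hne⟩ := Finset.one_lt_card.1 (by omega : 1 < S.card)
    have hpair : ∀ e ∈ S, {v, w} = e := by
      intro e he
      have h1' := mem_filter.1 (h1.1 he)
      have h2' := mem_filter.1 (h2.1 he)
      refine Finset.eq_of_subset_of_card_le ?_ ?_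
      · simp [insert_subset_iff, h1'.2, h2'.2]
      · rw [(mem_powersetCard.1 h1'.1).2, Finset.card_pair hvw]
    exact hne ((hpair x hx).symm.trans (hpair y hy))

/-- Two distinct four-element sets share at most three points, hence at most three pairs, so a
family of four or more pairs determines its four-element set. -/
theorem card_quads {k : ℕ} (hk : 4 ≤ k) :
    (quads α k).card = (Fintype.card α).choose 4 * Nat.choose 6 k := by
  rw [quads, Finset.card_biUnion]
  · rw [Finset.sum_congr rfl (g := fun _ => Nat.choose 6 k)]
    · simp [card_powersetCard]
    · intro U hU
      rw [card_powersetCard, card_powersetCard, (mem_powersetCard.1 hU).2]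
      rfl
  · intro U hU V hV hne
    rw [Function.onFun, Finset.disjoint_left]
    intro S h1 h2
    rw [mem_coe, mem_powersetCard] at hU hV
    rw [mem_powersetCard] at h1 h2
    have hlt := card_inter_lt_of_ne hne (hU.2.trans hV.2.symm)
    have := Finset.card_le_card (subset_powersetCard_inter h1.1 h2.1)
    rw [card_powersetCard] at this
    have h3 : (U ∩ V).card.choose 2 ≤ Nat.choose 3 2 := Nat.choose_le_choose 2 (by omega)
    have h4 : Nat.choose 3 2 = 3 := rfl
    omega

theorem card_clusters_of_four_le (h4 : 4 ≤ Fintype.card α) {k : ℕ} (hk : 4 ≤ k) :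
    (clusters α k).card = (matchings α k).card +
      Fintype.card α * (Fintype.card α - 1).choose k +
      (Fintype.card α).choose 4 * Nat.choose 6 k := by
  rw [clusters_eq h4, Finset.card_union_of_disjoint, Finset.card_union_of_disjoint, card_stars,
    card_quads hk]
  · omega
  · exact disjoint_matchings_stars (by omega)
  · rw [Finset.disjoint_union_left]
    exact ⟨disjoint_matchings_quads (by omega), disjoint_stars_quads hk⟩

/-- Three pairs through `v` involve only `v` and three further points. -/
theorem stars_three_subset_quads : stars α 3 ⊆ quads α 3 := by
  intro S hS
  obtain ⟨h2, hc, v, hv⟩ := mem_stars.1 hS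
  obtain ⟨x, y, z, hxy, hxz, hyz, rfl⟩ := Finset.card_eq_three.1 hc
  have key : ∀ e ∈ ({x, y, z} : Finset (Finset α)), ∃ w, w ≠ v ∧ e = {v, w} := by
    intro e he
    have := filter_mem_powersetCard_two (mem_univ v)
    have he' : e ∈ (powersetCard 2 (univ : Finset α)).filter (v ∈ ·) := by
      simp [mem_powersetCard, h2 e he, hv e he]
    rw [this] at he'
    obtain ⟨w, hw, rfl⟩ := mem_image.1 he'
    exact ⟨w, (mem_erase.1 hw).1, rfl⟩
  obtain ⟨a, ha, rfl⟩ := key x (by simp)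
  obtain ⟨b, hb, rfl⟩ := key y (by simp)
  obtain ⟨c, hcv, rfl⟩ := key z (by simp)
  have hab : a ≠ b := fun h => hxy (by rw [h])
  have hac : a ≠ c := fun h => hxz (by rw [h])
  have hbc : b ≠ c := fun h => hyz (by rw [h])
  refine mem_quads.2 ⟨{v, a, b, c}, ?_, ?_, hc⟩
  · rw [card_insert_of_notMem, Finset.card_eq_three.2 ⟨a, b, c, hab, hac, hbc, rfl⟩]
    simp [ha.symm, hb.symm, hcv.symm]
  · intro e he
    refine mem_powersetCard.2 ⟨?_, h2 e he⟩
    simp only [mem_insert, mem_singleton] at he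
    rcases he with rfl | rfl | rfl <;> simp [insert_subset_iff]

/-- A triangle can lie in several four-element sets, so triangles are counted once globally. Any
other triple determines its four-element set, and each such set carries 20 - 4 = 16 of them. -/
theorem card_quads_three (h4 : 4 ≤ Fintype.card α) :
    (quads α 3).card = (Fintype.card α).choose 3 + 16 * (Fintype.card α).choose 4 := by
  set F : Finset α → Finset (Finset (Finset α)) := fun U =>
    powersetCard 3 (powersetCard 2 U) \ triangles α U with hF
  have heq : quads α 3 = triangles α univ ∪ (powersetCard 4 univ).biUnion F := by
    ext S
    simp only [mem_quads, mem_union, mem_biUnion, hF, mem_sdiff, mem_powersetCard]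
    constructor
    · rintro ⟨U, hU, hS, hc⟩
      by_cases ht : S ∈ triangles α U
      · left
        exact image_subset_image (powersetCard_mono (subset_univ U)) ht
      · exact Or.inr ⟨U, ⟨subset_univ _, hU⟩, ⟨hS, hc⟩, ht⟩
    · rintro (ht | ⟨U, ⟨-, hU⟩, ⟨hS, hc⟩, -⟩)
      · have hm := mem_powersetCard.1 (triangles_subset univ ht)
        obtain ⟨T, hT, rfl⟩ := mem_image.1 ht
        obtain ⟨U, hTU, hU⟩ := Finset.exists_superset_card_eq (s := T) (n := 4)
          (by rw [(mem_powersetCard.1 hT).2]; omega) h4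
        exact ⟨U, hU, powersetCard_mono hTU, hm.2⟩
      · exact ⟨U, hU, hS, hc⟩
  have hFc : ∀ U ∈ powersetCard 4 (univ : Finset α), (F U).card = 16 := by
    intro U hU
    have hU := (mem_powersetCard.1 hU).2
    simp only [hF]
    rw [Finset.card_sdiff_of_subset (triangles_subset U), card_triangles, card_powersetCard,
      card_powersetCard, hU]
    rfl
  rw [heq, Finset.card_union_of_disjoint, card_triangles, Finset.card_biUnion,
    Finset.sum_congr rfl hFc]
  · simp [mul_comm]
  · intro U hU V hV hne
    rw [Function.onFun, Finset.disjoint_left]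
    intro S h1 h2
    simp only [hF, mem_sdiff, mem_powersetCard] at h1 h2
    rw [mem_coe, mem_powersetCard] at hU hV
    have hlt := card_inter_lt_of_ne hne (hU.2.trans hV.2.symm)
    have hsub := subset_powersetCard_inter h1.1.1 h2.1.1
    have h3 : (U ∩ V).card = 3 := by
      by_contra hcon
      have := Finset.card_le_card hsub
      rw [card_powersetCard] at this
      have h3 : (U ∩ V).card.choose 2 ≤ Nat.choose 2 2 := Nat.choose_le_choose 2 (by omega)
      have h4 : Nat.choose 2 2 = 1 := rfl
      omega
    apply h1.2
    refine mem_image.2 ⟨U ∩ V, mem_powersetCard.2 ⟨inter_subset_left, h3⟩, ?_⟩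
    refine (Finset.eq_of_subset_of_card_le hsub ?_).symm
    rw [card_powersetCard, h3, h1.1.2]
    rfl
  · rw [Finset.disjoint_left]
    intro S h1 h2
    obtain ⟨U, hU, h2⟩ := mem_biUnion.1 h2
    simp only [hF, mem_sdiff, mem_powersetCard] at h2
    obtain ⟨T, hT, rfl⟩ := mem_image.1 h1
    have hT := (mem_powersetCard.1 hT).2
    exact h2.2 (mem_image.2 ⟨T, mem_powersetCard.2
      ⟨subset_of_powersetCard_two_subset (by omega) h2.1.1, hT⟩, rfl⟩)

theorem card_clusters_three (h4 : 4 ≤ Fintype.card α) :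
    (clusters α 3).card = (matchings α 3).card +
      ((Fintype.card α).choose 3 + 16 * (Fintype.card α).choose 4) := by
  rw [clusters_eq h4, union_assoc, union_eq_right.2 stars_three_subset_quads,
    Finset.card_union_of_disjoint (disjoint_matchings_quads le_rfl), card_quads_three h4]

/-- A failure of transitivity needs three distinct pairs. -/
theorem card_clusters_of_le_two {k : ℕ} (hk : k ≤ 2) :
    (clusters α k).card = ((Fintype.card α).choose 2).choose k := by
  have : clusters α k = powersetCard k (powersetCard 2 univ) := by
    classical
    refine Finset.filter_true_of_mem fun S hS => ?_
    rw [mem_powersetCard] at hS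
    have hne : ∀ x ∈ S, ∀ y ∈ S, Disjoint x y → x ≠ y := by
      rintro x hx _ - hd rfl
      have := (mem_powersetCard.1 (hS.1 hx)).2
      rw [disjoint_self.1 hd] at this
      simp at this
    intro x hx y hy z hz hxy hyz hxz
    exfalso
    have h3 : ({x, y, z} : Finset (Finset α)).card = 3 :=
      Finset.card_eq_three.2 ⟨x, y, z, hne x hx y hy hxy, hxz, hne y hy z hz hyz, rfl⟩
    have := Finset.card_le_card (show ({x, y, z} : Finset (Finset α)) ⊆ S by
      simp [insert_subset_iff, hx, hy, hz])
    omega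
  rw [this, card_powersetCard, card_powersetCard, card_univ]

/-- Double counting of inclusions between matchings: a `(k+1)`-matching contains `k + 1` smaller
ones, and a `k`-matching is extended by any pair among the points it leaves uncovered. -/
theorem card_matchings_succ (k : ℕ) :
    (k + 1) * (matchings α (k + 1)).card =
      (Fintype.card α - 2 * k).choose 2 * (matchings α k).card := by
  classical
  have := Finset.card_mul_eq_card_mul (s := matchings α (k + 1)) (t := matchings α k)
    (fun M N => N ⊆ M) (m := k + 1) (n := (Fintype.card α - 2 * k).choose 2) ?_ ?_
  · rw [mul_comm (k + 1), this, mul_comm]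
  · intro M hM
    obtain ⟨h2, hc, hd⟩ := mem_matchings.1 hM
    have : (matchings α k).bipartiteAbove (fun M N => N ⊆ M) M = powersetCard k M := by
      ext N
      simp only [mem_bipartiteAbove, mem_matchings, mem_powersetCard]
      constructor
      · exact fun h => ⟨h.2, h.1.2.1⟩
      · exact fun h => ⟨⟨fun e he => h2 e (h.1 he), h.2, hd.subset (by exact_mod_cast h.1)⟩, h.1⟩
    rw [this, card_powersetCard, hc, Nat.choose_succ_self_right]
  · intro N hN
    obtain ⟨h2, hc, hd⟩ := mem_matchings.1 hN
    have hnot : ∀ e ∈ powersetCard 2 (univ \ N.biUnion id), e.card = 2 ∧ ∀ f ∈ N, Disjoint e f := by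
      intro e he
      rw [mem_powersetCard, subset_sdiff] at he
      refine ⟨he.2, fun f hf => ?_⟩
      exact Finset.disjoint_of_subset_right (subset_biUnion_of_mem id hf) he.1.2
    have hnm : ∀ e ∈ powersetCard 2 (univ \ N.biUnion id), e ∉ N := by
      intro e he heN
      have h := hnot e he
      have h0 := disjoint_self.1 (h.2 e heN)
      rw [h0] at h
      simp at h
    have : (matchings α (k + 1)).bipartiteBelow (fun M N => N ⊆ M) N =
        (powersetCard 2 (univ \ N.biUnion id)).image fun e => insert e N := by
      ext M
      simp only [mem_bipartiteBelow, mem_image]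
      constructor
      · rintro ⟨hM, hNM⟩
        obtain ⟨hM2, hMc, hMd⟩ := mem_matchings.1 hM
        have h1 : (M \ N).card = 1 := by rw [card_sdiff_of_subset hNM]; omega
        obtain ⟨e, he⟩ := Finset.card_eq_one.1 h1
        have heM : e ∈ M \ N := by rw [he]; simp
        rw [mem_sdiff] at heM
        refine ⟨e, ?_, ?_⟩
        · rw [mem_powersetCard, subset_sdiff]
          refine ⟨⟨subset_univ _, ?_⟩, hM2 e heM.1⟩
          rw [Finset.disjoint_biUnion_right]
          intro f hf
          exact hMd heM.1 (hNM hf) (fun h => heM.2 (h ▸ hf))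
        · rw [Finset.insert_eq, ← he, sdiff_union_of_subset hNM]
      · rintro ⟨e, he, rfl⟩
        refine ⟨mem_matchings.2 ⟨?_, ?_, ?_⟩, subset_insert _ _⟩
        · intro f hf
          rcases mem_insert.1 hf with rfl | hf
          · exact (hnot _ he).1
          · exact h2 f hf
        · rw [card_insert_of_notMem (hnm e he), hc]
        · rw [coe_insert]
          exact hd.insert fun f hf _ => (hnot e he).2 f hf
    rw [this, Finset.card_image_of_injOn, card_powersetCard, card_sdiff_of_subset (subset_univ _),
      card_biUnion_of_mem_matchings hN, card_univ]
    intro e he f hf hef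
    have : e ∈ insert f N := by
      have : insert e N = insert f N := hef
      rw [← this]; simp
    exact (mem_insert.1 this).resolve_right (hnm e he)

end EdgeSets

/-! ### From general position sets of the Kneser graph to families of pairs -/

section Kneser

variable {n : ℕ}

/-- Counting general position sets of `K(n,k)` as families of `k`-element sets. -/
theorem numGeneralPositionSets_kneserGraph_eq_card {k : ℕ} (Q : Finset (Finset (Fin n)) → Prop)
    [DecidablePred Q]
    (hQ : ∀ S : Finset {s : Finset (Fin n) // s.card = k},
      IsGeneralPositionSet (kneserGraph n k) S ↔ Q (S.map (Function.Embedding.subtype _))) (i : ℕ) :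
    numGeneralPositionSets (kneserGraph n k) i =
      ((powersetCard i (powersetCard k (univ : Finset (Fin n)))).filter Q).card := by
  rw [numGeneralPositionSets, ← Set.ncard_coe_finset,
    ← Set.ncard_image_of_injective _
      (Finset.map_injective (Function.Embedding.subtype fun s : Finset (Fin n) => s.card = k))]
  congr 1
  ext T
  simp only [Set.mem_image, Set.mem_ofPred_eq, mem_coe, mem_filter, mem_powersetCard]
  constructor
  · rintro ⟨S, ⟨hc, hS⟩, rfl⟩
    refine ⟨⟨fun e he => ?_, by rw [card_map, hc]⟩, (hQ S).1 hS⟩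
    obtain ⟨a, -, rfl⟩ := mem_map.1 he
    exact mem_powersetCard.2 ⟨subset_univ _, a.2⟩
  · rintro ⟨⟨hsub, hc⟩, hT⟩
    have hmap : (T.subtype fun s => s.card = k).map (Function.Embedding.subtype _) = T :=
      Finset.subtype_map_of_mem fun e he => (mem_powersetCard.1 (hsub he)).2
    refine ⟨T.subtype fun s => s.card = k, ⟨?_, (hQ _).2 (by rwa [hmap])⟩, hmap⟩
    rw [← hc, ← card_map (Function.Embedding.subtype _), hmap]

/-- Two intersecting pairs cover at most three points, so with `n ≥ 5` there is room for a pair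
disjoint from both. -/
theorem kneserGraph_two_dist_le_two (hn : 5 ≤ n) (u v : {s : Finset (Fin n) // s.card = 2}) :
    (kneserGraph n 2).dist u v ≤ 2 := by
  by_cases huv : u = v
  · simp [huv]
  by_cases hd : Disjoint u.1 v.1
  · have h : (kneserGraph n 2).Adj u v := ⟨huv, hd⟩
    exact (SimpleGraph.dist_le h.toWalk).trans (by simp)
  · have hcard : 2 ≤ (univ \ (u.1 ∪ v.1)).card := by
      have h1 := Finset.card_union_add_card_inter u.1 v.1
      have h2 := Finset.card_pos.2 (Finset.not_disjoint_iff_nonempty_inter.1 hd)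
      rw [Finset.card_sdiff_of_subset (subset_univ _), card_univ, Fintype.card_fin]
      have := u.2
      have := v.2
      omega
    obtain ⟨w, hw, hwc⟩ := Finset.exists_subset_card_eq hcard
    rw [subset_sdiff, disjoint_union_right] at hw
    have hne : ∀ x : {s : Finset (Fin n) // s.card = 2}, Disjoint w x.1 → ⟨w, hwc⟩ ≠ x := by
      rintro x hx rfl
      rw [disjoint_self.1 hx] at hwc
      simp at hwc
    have h1 : (kneserGraph n 2).Adj u ⟨w, hwc⟩ := ⟨(hne u hw.2.1).symm, hw.2.1.symm⟩
    have h2 : (kneserGraph n 2).Adj ⟨w, hwc⟩ v := ⟨hne v hw.2.2, hw.2.2⟩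
    exact (SimpleGraph.dist_le (.cons h1 (.cons h2 .nil))).trans (by simp)

/-- A shortest path has length at most two, so one with three vertices joins non-adjacent endpoints
through a common neighbour: precisely a failure of transitivity. -/
theorem isGeneralPositionSet_kneserGraph_two_iff (hn : 5 ≤ n)
    (S : Finset {s : Finset (Fin n) // s.card = 2}) :
    IsGeneralPositionSet (kneserGraph n 2) S ↔
      IsCluster (S.map (Function.Embedding.subtype _)) := by
  have hne : ∀ x y : {s : Finset (Fin n) // s.card = 2}, Disjoint x.1 y.1 → x ≠ y := by
    rintro x _ hd rfl
    have := x.2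
    rw [disjoint_self.1 hd] at this
    simp at this
  constructor
  · intro h x' hx' y' hy' z' hz' hxy hyz hxz
    obtain ⟨x, hx, rfl⟩ := mem_map.1 hx'
    obtain ⟨y, hy, rfl⟩ := mem_map.1 hy'
    obtain ⟨z, hz, rfl⟩ := mem_map.1 hz'
    change Disjoint x.1 y.1 at hxy
    change Disjoint y.1 z.1 at hyz
    have hxz : x ≠ z := fun h => hxz (by rw [h])
    by_contra hd
    have h1 : (kneserGraph n 2).Adj x y := ⟨hne x y hxy, hxy⟩
    have h2 : (kneserGraph n 2).Adj y z := ⟨hne y z hyz, hyz⟩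
    let p : (kneserGraph n 2).Walk x z := .cons h1 (.cons h2 .nil)
    refine h x hx y hy z hz h1.1 hxz h2.1 ⟨x, z, p, ⟨?_, ?_⟩, ?_⟩
    · simp [p, h1.1, h2.1, hxz]
    · have hle := kneserGraph_two_dist_le_two hn x z
      have h0 : (kneserGraph n 2).dist x z ≠ 0 := (p.reachable.pos_dist_of_ne hxz).ne'
      have h1 : (kneserGraph n 2).dist x z ≠ 1 := fun h1 =>
        hd (SimpleGraph.dist_eq_one_iff_adj.1 h1).2
      have : p.length = 2 := rfl
      omega
    · simp [p]
  · rintro h x hx y hy z hz hxy hxz hyz ⟨u, v, p, ⟨hp, hl⟩, hxp, hyp, hzp⟩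
    have hle := kneserGraph_two_dist_le_two hn u v
    match p, hp, hl, hxp, hyp, hzp with
    | .nil, _, _, hxp, hyp, _ => simp_all
    | .cons _ .nil, _, _, hxp, hyp, hzp =>
      simp only [SimpleGraph.Walk.support_cons, SimpleGraph.Walk.support_nil, List.mem_cons,
        List.not_mem_nil, or_false] at hxp hyp hzp
      clear * - hxp hyp hzp hxy hxz hyz
      grind
    | .cons (v := w) h1 (.cons h2 .nil), hp, hl, hxp, hyp, hzp =>
      simp only [SimpleGraph.Walk.support_cons, SimpleGraph.Walk.support_nil, List.mem_cons,
        List.not_mem_nil, or_false] at hxp hyp hzp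
      have hmem : u ∈ S ∧ w ∈ S ∧ v ∈ S := by
        clear * - hxp hyp hzp hxy hxz hyz hx hy hz
        grind
      have huv : u ≠ v := by
        rintro rfl
        simp at hl
      have hd : Disjoint u.1 v.1 := h u.1 (mem_map_of_mem _ hmem.1) w.1 (mem_map_of_mem _ hmem.2.1)
        v.1 (mem_map_of_mem _ hmem.2.2) h1.2 h2.2 (fun h => huv (Subtype.ext h))
      have hadj : (kneserGraph n 2).Adj u v := ⟨huv, hd⟩
      rw [SimpleGraph.dist_eq_one_iff_adj.2 hadj] at hl
      simp at hl
    | .cons _ (.cons _ (.cons _ q)), _, hl, _, _, _ =>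
      simp only [SimpleGraph.Walk.length_cons] at hl
      omega

/-- A pair has at most one disjoint partner, its complement, so no path has three vertices. -/
theorem isGeneralPositionSet_kneserGraph_two_of_le_four (hn : n ≤ 4)
    (S : Finset {s : Finset (Fin n) // s.card = 2}) :
    IsGeneralPositionSet (kneserGraph n 2) S := by
  rintro x hx y hy z hz hxy hxz hyz ⟨u, v, p, ⟨hp, hl⟩, hxp, hyp, hzp⟩
  match p, hp, hxp, hyp, hzp with
  | .nil, _, hxp, hyp, _ => simp_all
  | .cons _ .nil, _, hxp, hyp, hzp =>
    simp only [SimpleGraph.Walk.support_cons, SimpleGraph.Walk.support_nil, List.mem_cons,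
      List.not_mem_nil, or_false] at hxp hyp hzp
    clear * - hxp hyp hzp hxy hxz hyz
    grind
  | .cons (v := a) h1 (.cons (v := b) h2 q), hp, _, _, _ =>
    have hub : u ≠ b := by
      rintro rfl
      simp [SimpleGraph.Walk.cons_isPath_iff] at hp
    have compl : ∀ t : {s : Finset (Fin n) // s.card = 2}, Disjoint t.1 a.1 →
        t.1 = univ \ a.1 := by
      intro t ht
      apply Finset.eq_of_subset_of_card_le (subset_sdiff.2 ⟨subset_univ _, ht⟩)
      rw [card_sdiff_of_subset (subset_univ _), card_univ, Fintype.card_fin, t.2, a.2]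
      omega
    exact hub (Subtype.ext ((compl u h1.2).trans (compl b h2.2.symm).symm))

theorem numGeneralPositionSets_kneserGraph_two (hn : 5 ≤ n) (i : ℕ) :
    numGeneralPositionSets (kneserGraph n 2) i = (clusters (Fin n) i).card := by
  classical
  rw [numGeneralPositionSets_kneserGraph_eq_card IsCluster
    (isGeneralPositionSet_kneserGraph_two_iff hn), clusters]

theorem numGeneralPositionSets_kneserGraph_two_of_le_four (hn : n ≤ 4) (i : ℕ) :
    numGeneralPositionSets (kneserGraph n 2) i = (n.choose 2).choose i := by
  rw [numGeneralPositionSets_kneserGraph_eq_card (fun _ => True)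
    (fun S => iff_true_intro (isGeneralPositionSet_kneserGraph_two_of_le_four hn S)),
    filter_true, card_powersetCard, card_powersetCard, card_univ, Fintype.card_fin]

theorem coeff_generalPositionPolynomial {V : Type*} [Fintype V] (G : SimpleGraph V) (i : ℕ) :
    (generalPositionPolynomial G).coeff i = numGeneralPositionSets G i := by
  simp only [generalPositionPolynomial, Polynomial.finsetSum_coeff, Polynomial.coeff_C_mul_X_pow]
  rw [Finset.sum_ite_eq]
  split_ifs with h
  · rfl
  · symm
    rw [numGeneralPositionSets, Set.ncard_eq_zero, Set.eq_empty_iff_forall_notMem]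
    rintro S ⟨hS, -⟩
    have := Finset.card_le_univ S
    rw [mem_range] at h
    omega

end Kneser

/-! ### Unimodality of the coefficient sequence -/

section Unimodality

/-- The number of `k`-edge matchings of the complete graph on `n` vertices. -/
def matchingNumber (n : ℕ) : ℕ → ℕ
  | 0 => 1
  | k + 1 => (n - 2 * k).choose 2 * matchingNumber n k / (k + 1)

/-- The number of general position sets of cardinality `k` in `K(n,2)`, for `n ≥ 5`. -/
def kneserTwoCoeff (n k : ℕ) : ℕ :=
  if k ≤ 2 then (n.choose 2).choose k
  else if k = 3 then matchingNumber n 3 + (n.choose 3 + 16 * n.choose 4)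
  else matchingNumber n k + n * (n - 1).choose k + n.choose 4 * Nat.choose 6 k

theorem card_matchings (n k : ℕ) : (matchings (Fin n) k).card = matchingNumber n k := by
  induction k with
  | zero => exact card_matchings_zero
  | succ k ih =>
    have h := card_matchings_succ (α := Fin n) k
    rw [Fintype.card_fin, ih] at h
    rw [matchingNumber, ← h, Nat.mul_div_cancel_left _ k.succ_pos]

/-- The double count shows that the natural-number division in the recursion is exact. -/
theorem matchingNumber_succ (n k : ℕ) :
    (k + 1) * matchingNumber n (k + 1) = (n - 2 * k).choose 2 * matchingNumber n k := by
  have h := card_matchings_succ (α := Fin n) k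
  rwa [Fintype.card_fin, card_matchings, card_matchings] at h

theorem card_clusters {n : ℕ} (hn : 5 ≤ n) (k : ℕ) :
    (clusters (Fin n) k).card = kneserTwoCoeff n k := by
  have h4 : 4 ≤ Fintype.card (Fin n) := by rw [Fintype.card_fin]; omega
  rw [kneserTwoCoeff]
  split_ifs with h2 h3
  · rw [card_clusters_of_le_two h2, Fintype.card_fin]
  · rw [h3, card_clusters_three h4, card_matchings, Fintype.card_fin]
  · rw [card_clusters_of_four_le h4 (by omega), card_matchings, Fintype.card_fin]

theorem matchingNumber_mul_factorial {n k : ℕ} (h : 2 * k ≤ n) :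
    matchingNumber n k * (k.factorial * 2 ^ k * (n - 2 * k).factorial) = n.factorial := by
  induction k with
  | zero => simp [matchingNumber]
  | succ k ih =>
    have h1 := Nat.choose_mul_factorial_mul_factorial (n := n - 2 * k) (k := 2) (by omega)
    rw [show n - 2 * k - 2 = n - 2 * (k + 1) by omega, Nat.factorial_two] at h1
    rw [← ih (by omega), ← h1, Nat.factorial_succ, pow_succ]
    linear_combination (k.factorial * 2 ^ k * 2 * (n - 2 * (k + 1)).factorial) *
      matchingNumber_succ n k

/-- This is the comparison of stars with matchings after cancelling common factors, with `r = n -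
2k`. Raising `k` by one doubles the left side and multiplies the right side by `k + r`. -/
theorem factorial_bound {r k : ℕ} (hr : 2 ≤ r) (hk : 3 ≤ k) :
    r.factorial * 2 ^ k * (r - 2) ≤ (k + r - 1).factorial := by
  induction k, hk using Nat.le_induction with
  | base =>
    obtain ⟨t, rfl⟩ := Nat.exists_eq_add_of_le hr
    rw [show 3 + (2 + t) - 1 = 2 + t + 1 + 1 by omega, Nat.factorial_succ, Nat.factorial_succ,
      Nat.add_sub_cancel_left]
    have : 8 * t ≤ (2 + t + 1 + 1) * (2 + t + 1) := by
      nlinarith [Nat.le_mul_self t]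
    calc (2 + t).factorial * 2 ^ 3 * t = (8 * t) * (2 + t).factorial := by ring
      _ ≤ (2 + t + 1 + 1) * (2 + t + 1) * (2 + t).factorial := Nat.mul_le_mul_right _ this
      _ = _ := by ring
  | succ k hk ih =>
    rw [show k + 1 + r - 1 = k + r - 1 + 1 by omega, Nat.factorial_succ, pow_succ]
    calc r.factorial * (2 ^ k * 2) * (r - 2) = 2 * (r.factorial * 2 ^ k * (r - 2)) := by ring
      _ ≤ _ := Nat.mul_le_mul (by omega) ih

theorem matchingNumber_le_succ {n k : ℕ} (h : k + 1 ≤ (n - 2 * k).choose 2) :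
    matchingNumber n k ≤ matchingNumber n (k + 1) := by
  refine Nat.le_of_mul_le_mul_left ?_ k.succ_pos
  rw [Nat.succ_eq_add_one, matchingNumber_succ]
  exact Nat.mul_le_mul_right _ h

theorem matchingNumber_succ_le {n k : ℕ} (h : (n - 2 * k).choose 2 ≤ k) :
    matchingNumber n (k + 1) ≤ matchingNumber n k := by
  refine Nat.le_of_mul_le_mul_left ?_ k.succ_pos
  rw [Nat.succ_eq_add_one, matchingNumber_succ]
  exact Nat.mul_le_mul_right _ (by omega)

theorem choose_le_succ_of_two_mul {n k : ℕ} (h : 2 * k + 2 ≤ n) :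
    (n - 1).choose k ≤ (n - 1).choose (k + 1) := by
  refine Nat.le_of_mul_le_mul_right ?_ k.succ_pos
  rw [Nat.succ_eq_add_one, Nat.choose_succ_right_eq]
  exact Nat.mul_le_mul_left _ (by omega)

theorem choose_succ_le_of_two_mul {n k : ℕ} (h : n ≤ 2 * k + 2) :
    (n - 1).choose (k + 1) ≤ (n - 1).choose k := by
  refine Nat.le_of_mul_le_mul_right ?_ k.succ_pos
  rw [Nat.succ_eq_add_one, Nat.choose_succ_right_eq]
  exact Nat.mul_le_mul_left _ (by omega)

/-- The factor `n - 2k - 2` is the one that governs the growth of the star term: `k + 1` times its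
increment from `k` to `k + 1` equals the left side. -/
theorem star_mul_le_matchingNumber {n k : ℕ} (hk : 3 ≤ k) (hn : 2 * k + 2 ≤ n) :
    n * (n - 1).choose k * (n - 2 * k - 2) ≤ matchingNumber n k := by
  have h1 := matchingNumber_mul_factorial (n := n) (k := k) (by omega)
  have h2 := Nat.choose_mul_factorial_mul_factorial (n := n - 1) (k := k) (by omega)
  have h3 := Nat.mul_factorial_pred (n := n) (by omega)
  have h4 := factorial_bound (r := n - 2 * k) (k := k) (by omega) hk
  rw [show k + (n - 2 * k) - 1 = n - 1 - k by omega] at h4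
  have hpos : 0 < k.factorial * 2 ^ k * (n - 2 * k).factorial := by positivity
  refine Nat.le_of_mul_le_mul_right ?_ hpos
  rw [h1, ← h3, ← h2]
  calc _ = n * ((n - 1).choose k * k.factorial *
        ((n - 2 * k).factorial * 2 ^ k * (n - 2 * k - 2))) := by ring
    _ ≤ _ := Nat.mul_le_mul_left _ (Nat.mul_le_mul_left _ h4)

/-- If stars still increase, compare increments scaled by `k + 1`: matchings lose at least
`matchingNumber n k`, and stars gain at most that. -/
theorem matchingNumber_add_star_succ_le {n k : ℕ} (h : (n - 2 * k).choose 2 ≤ k) :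
    matchingNumber n (k + 1) + n * (n - 1).choose (k + 1) ≤
      matchingNumber n k + n * (n - 1).choose k := by
  rcases le_or_gt n (2 * k + 2) with hn | hn
  · exact add_le_add (matchingNumber_succ_le h)
      (Nat.mul_le_mul_left _ (choose_succ_le_of_two_mul hn))
  -- Here `n - 2k ≥ 3`, so `h` itself gives `3 = Nat.choose 3 2 ≤ k`.
  · have h3 : 3 ≤ k := le_trans (Nat.choose_le_choose 2 (by omega : 3 ≤ n - 2 * k)) h
    have h1 := matchingNumber_succ n k
    have h2 := Nat.choose_succ_right_eq (n - 1) k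
    have h4 := star_mul_le_matchingNumber h3 hn.le
    rw [show n - 1 - k = (k + 1) + (n - 2 * k - 2) by omega] at h2
    have h5 := Nat.mul_le_mul_right (matchingNumber n k) h
    refine Nat.le_of_mul_le_mul_left ?_ k.succ_pos
    calc (k + 1) * (matchingNumber n (k + 1) + n * (n - 1).choose (k + 1))
        = (k + 1) * matchingNumber n (k + 1) + n * ((n - 1).choose (k + 1) * (k + 1)) := by ring
      _ = (n - 2 * k).choose 2 * matchingNumber n k + n * (n - 1).choose k * (k + 1) +
          n * (n - 1).choose k * (n - 2 * k - 2) := by rw [h1, h2]; ring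
      _ ≤ k * matchingNumber n k + n * (n - 1).choose k * (k + 1) + matchingNumber n k := by
          gcongr
      _ = (k + 1) * (matchingNumber n k + n * (n - 1).choose k) := by ring

theorem kneserTwoCoeff_of_seven_le {n k : ℕ} (hk : 7 ≤ k) :
    kneserTwoCoeff n k = matchingNumber n k + n * (n - 1).choose k := by
  rw [kneserTwoCoeff, if_neg (by omega), if_neg (by omega),
    Nat.choose_eq_zero_of_lt (by omega : 6 < k), mul_zero, add_zero]

theorem matchingNumber_eq_zero {n k : ℕ} (h : n < 2 * k) : matchingNumber n k = 0 := by
  rw [← card_matchings, Finset.card_eq_zero, Finset.eq_empty_iff_forall_notMem]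
  intro S hS
  have h1 := card_biUnion_of_mem_matchings hS
  have h2 := Finset.card_le_univ (S.biUnion id)
  rw [Fintype.card_fin] at h2
  omega

/-! ### Initial growth, small cases and the location of the mode -/

theorem kneserTwoCoeff_le_succ_of_lt_seven {n k : ℕ} (hn : 17 ≤ n) (hk : k < 7) :
    kneserTwoCoeff n k ≤ kneserTwoCoeff n (k + 1) := by
  -- The threshold 17 enters here: `k ≤ 6` gives `n - 2k ≥ 5`, and `Nat.choose 5 2 = 10` exceeds
  -- `k`. The other terms are compared by writing them all as binomials `n.choose j` with explicit
  -- ratios.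
  have hm : matchingNumber n k ≤ matchingNumber n (k + 1) :=
    matchingNumber_le_succ ((by simp [Nat.choose]; omega : k + 1 ≤ Nat.choose 5 2).trans
      (Nat.choose_le_choose 2 (by omega)))
  have star : ∀ j, n * (n - 1).choose j = n.choose (j + 1) * (j + 1) := by
    intro j
    have := Nat.add_one_mul_choose_eq (n - 1) j
    rwa [Nat.sub_add_cancel (by omega)] at this
  have grow : ∀ j, n.choose (j + 1) * (j + 1) = n.choose j * (n - j) :=
    Nat.choose_succ_right_eq n
  obtain ⟨t, rfl⟩ := Nat.exists_eq_add_of_le hn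
  have g1 := grow 1
  have g2 := grow 2
  have g3 := grow 3
  have g4 := grow 4
  have g5 := grow 5
  have g6 := grow 6
  have g7 := grow 7
  rw [Nat.choose_one_right] at g1
  simp only [Nat.reduceAdd] at g1 g2 g3 g4 g5 g6 g7
  rw [show 17 + t - 1 = 16 + t by omega] at g1
  rw [show 17 + t - 2 = 15 + t by omega] at g2
  rw [show 17 + t - 3 = 14 + t by omega] at g3
  rw [show 17 + t - 4 = 13 + t by omega] at g4
  rw [show 17 + t - 5 = 12 + t by omega] at g5
  rw [show 17 + t - 6 = 11 + t by omega] at g6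
  rw [show 17 + t - 7 = 10 + t by omega] at g7
  have g0 := Nat.choose_succ_right_eq ((17 + t).choose 2) 1
  rw [Nat.choose_one_right] at g0
  simp only [Nat.reduceAdd] at g0
  generalize hNt : (17 + t).choose 2 = N at *
  have hN : 3 ≤ N := by nlinarith
  interval_cases k <;>
    simp only [kneserTwoCoeff, hNt, star, Nat.reduceAdd, Nat.reduceLeDiff, Nat.reduceEqDiff, if_true,
      if_false, Nat.choose_zero_right, Nat.choose_one_right, zero_le, le_refl,
      show Nat.choose 6 4 = 15 from rfl, show Nat.choose 6 5 = 6 from rfl,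
      show Nat.choose 6 6 = 1 from rfl, show Nat.choose 6 7 = 0 from rfl] at hm ⊢
  · omega
  · obtain ⟨s, rfl⟩ := Nat.exists_eq_add_of_le hN
    rw [show 3 + s - 1 = 2 + s by omega] at g0
    nlinarith
  -- Matchings are not needed: `2 * (n.choose 3 + 16 * n.choose 4)` is `N * (n-2) * (2 + 8(n-3)) /
  -- 3`, which `h2` makes at least `N * N`.
  · have h1 : N.choose 2 * 2 ≤ N * N := by rw [g0]; exact Nat.mul_le_mul_left _ (by omega)
    have h2 : 3 * N ≤ (15 + t) * (2 + 8 * (14 + t)) := by nlinarith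
    have h3 := Nat.mul_le_mul_left N h2
    nlinarith
  · nlinarith
  · nlinarith
  · nlinarith
  · nlinarith

theorem kneserTwoCoeff_small : ∀ n < 17, 5 ≤ n → ∃ M < 8,
    (∀ k < M, kneserTwoCoeff n k ≤ kneserTwoCoeff n (k + 1)) ∧
      ∀ k < 17, M ≤ k → kneserTwoCoeff n (k + 1) ≤ kneserTwoCoeff n k := by
  decide +kernel

theorem exists_mode_kneserTwoCoeff {n : ℕ} (hn : 5 ≤ n) :
    ∃ M, (∀ k < M, kneserTwoCoeff n k ≤ kneserTwoCoeff n (k + 1)) ∧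
      ∀ k, M ≤ k → kneserTwoCoeff n (k + 1) ≤ kneserTwoCoeff n k := by
  rcases lt_or_ge n 17 with h17 | h17
  · obtain ⟨M, -, h1, h2⟩ := kneserTwoCoeff_small n h17 hn
    refine ⟨M, h1, fun k hk => ?_⟩
    rcases lt_or_ge k 17 with hk' | hk'
    · exact h2 k hk' hk
    -- For `k ≥ 17 > n` the next coefficient vanishes, so the finite check suffices.
    · rw [kneserTwoCoeff_of_seven_le (by omega), matchingNumber_eq_zero (by omega),
        Nat.choose_eq_zero_of_lt (by omega)]
      exact Nat.zero_le _
  · have hex : ∃ k, (n - 2 * k).choose 2 ≤ k :=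
      ⟨n, by rw [show n - 2 * n = 0 by omega]; exact Nat.zero_le _⟩
    have hlow : ∀ k < Nat.find hex, k + 1 ≤ (n - 2 * k).choose 2 := fun k hk =>
      not_le.1 (Nat.find_min hex hk)
    have h7 : 7 ≤ Nat.find hex := by
      rw [Nat.le_find_iff]
      intro k hk
      have h1 : Nat.choose 5 2 ≤ (n - 2 * k).choose 2 := Nat.choose_le_choose 2 (by omega)
      have h2 : Nat.choose 5 2 = 10 := rfl
      omega
    refine ⟨Nat.find hex, fun k hk => ?_, fun k hk => ?_⟩
    · rcases lt_or_ge k 7 with hk7 | hk7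
      · exact kneserTwoCoeff_le_succ_of_lt_seven h17 hk7
      · have h := hlow k hk
        -- Before the mode the binomial is positive, so `2k + 2 ≤ n` and the star term is still
        -- increasing as well.
        have h2 : 2 ≤ n - 2 * k := by
          by_contra hcon
          rw [Nat.choose_eq_zero_of_lt (by omega)] at h
          omega
        rw [kneserTwoCoeff_of_seven_le hk7, kneserTwoCoeff_of_seven_le (by omega)]
        exact add_le_add (matchingNumber_le_succ h)
          (Nat.mul_le_mul_left _ (choose_le_succ_of_two_mul (by omega)))
    · rw [kneserTwoCoeff_of_seven_le (by omega), kneserTwoCoeff_of_seven_le (by omega)]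
      exact matchingNumber_add_star_succ_le
        (((Nat.choose_le_choose 2 (by omega)).trans (Nat.find_spec hex)).trans hk)

theorem exists_mode_choose (N : ℕ) :
    ∃ M, (∀ k < M, N.choose k ≤ N.choose (k + 1)) ∧
      ∀ k, M ≤ k → N.choose (k + 1) ≤ N.choose k := by
  refine ⟨N / 2, fun k hk => Nat.choose_le_succ_of_lt_half_left hk, fun k hk => ?_⟩
  exact choose_succ_le_of_two_mul (n := N + 1) (by omega)

theorem isUnimodalPolynomial_of_exists_mode {p : Polynomial ℕ}
    (h : ∃ M, (∀ k < M, p.coeff k ≤ p.coeff (k + 1)) ∧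
      ∀ k, M ≤ k → p.coeff (k + 1) ≤ p.coeff k) : IsUnimodalPolynomial p := by
  obtain ⟨M, h1, h2⟩ := h
  refine ⟨M, fun i j hij => ?_, fun i j hi hij => ?_⟩
  · induction j, hij using Nat.le_induction with
    | base => exact fun _ => le_rfl
    | succ j _ ih => exact fun hj => (ih (by omega)).trans (h1 j hj)
  · induction j, hij using Nat.le_induction with
    | base => exact le_rfl
    | succ j hj ih => exact (h2 j (hi.trans hj)).trans ih

end Unimodality

theorem theorem4p2 (n : ℕ) (hn : 2 ≤ n) :
    IsUnimodalPolynomial (generalPositionPolynomial (kneserGraph n 2)) := by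
  apply isUnimodalPolynomial_of_exists_mode
  simp only [coeff_generalPositionPolynomial]
  rcases le_or_gt n 4 with h4 | h4
  · simp only [numGeneralPositionSets_kneserGraph_two_of_le_four h4]
    exact exists_mode_choose _
  · simp only [numGeneralPositionSets_kneserGraph_two h4, card_clusters h4]
    exact exists_mode_kneserTwoCoeff h4
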